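/- Let $(S,\mathfrak m)$ be a (commutative, Noetherian) local ring of dimension $d$ which is a homomorphic image of a Gorenstein ring, and let $\omega_S$ be a canonical module of $S$, i.e. a finitely generated $S$-module with $\operatorname{Hom}_S(\omega_S,E_S(S/\mathfrak m))\cong H^d_{\mathfrak m}(S)$. Let $\mathfrak q$ be an ideal of $S$ of height $d-1$, let $x_1\in S$ be such that $(\mathfrak q,x_1)$ is $\mathfrak m$-primary, and let $w\ge 1$ be an integer. For an ideal $I$, an $S$-module $M$ and $i\ge 0$, let $H^i_I(M)=\varinjlim_m \operatorname{Ext}^i_S(S/I^m,M)$, and let $\Theta^M_I:\operatorname{Ext}^d_S(S/I,M)\to H^d_I(M)$ be the natural map. For an $\mathfrak m$-primary ideal $I$ and a free resolution $F_\bullet$ of $S/I$, put $\operatorname{syz}_d=F_d/\operatorname{im}(F_{d+1}\to F_d)$, let $\epsilon_I\in\operatorname{Ext}^d_S(S/I,\operatorname{syz}_d)$ be the class of the natural epimorphism $F_d\to\operatorname{syz}_d$, and let $\eta_I=\Theta^{\operatorname{syz}_d}_I(\epsilon_I)\in H^d_I(\operatorname{syz}_d)$ be the canonical element of $S$ with respect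 to $I$ (computed from $F_\bullet$). Then, for any free resolution $F_\bullet$ of $S/(\mathfrak q,x_1^w)$, the following statements are equivalent: (i) $x_1^{w-1}\,\eta_{(\mathfrak q,x_1^w)}\neq 0$; (ii) the composite $$\operatorname{Ext}^d_S\big(S/(\mathfrak q,x_1^w),\omega_S\big)\xrightarrow{\ \operatorname{Ext}^d_S(\nu_w,\mathrm{id})\ }\operatorname{Ext}^d_S\big(S/(\mathfrak q,x_1),\omega_S\big)\xrightarrow{\ \Theta^{\omega_S}_{(\mathfrak q,x_1)}\ }H^d_{(\mathfrak q,x_1)}(\omega_S)$$ is non-zero, where $\nu_w:S/(\mathfrak q,x_1)\to S/(\mathfrak q,x_1^w)$ is multiplication by $x_1^{w-1}$; (iii) the composite $$\operatorname{Ext}^d_S\big(S/(\mathfrak q,x_1^w),\omega_S\big)\xrightarrow{\ \Theta^{\omega_S}_{(\mathfrak q,x_1^w)}\ }H^d_{(\mathfrak q,x_1^w)}(\omega_S)\xrightarrow{\ x_1^{w-1}\ }H^d_{(\mathfrak q,x_1^w)}(\omega_S)$$ is non-zero. -/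

import Mathlib

open CategoryTheory CategoryTheory.Abelian

universe u v

noncomputable section

namespace CanonicalElement

/-- A ring is Gorenstein if it is Noetherian and each of its localizations at a prime ideal has
finite injective dimension as a module over itself. -/
structure IsGorensteinRing (G : Type v) [CommRing G] : Prop where
  noetherian : IsNoetherianRing G
  finite_injectiveDimension : ∀ (p : Ideal G) [p.IsPrime], ∃ n : ℕ,
    HasInjectiveDimensionLT
      (ModuleCat.of (Localization.AtPrime p) (Localization.AtPrime p)) n

section

variable {S : Type u} [CommRing S]

/-- The cyclic module `S/I` as an object of the category of `S`-modules. -/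
abbrev quot (I : Ideal S) : ModuleCat.{u} S := ModuleCat.of S (S ⧸ I)

/-- The natural epimorphism `S/J → S/I` for `J ≤ I`. -/
def quotMap {J I : Ideal S} (h : J ≤ I) : quot J ⟶ quot I :=
  ModuleCat.ofHom (Submodule.factor h)

/-- The `S`-linear map `Ext^i(X, M) → Ext^i(Y, M)` induced by `f : Y → X`. -/
def extMap {X Y : ModuleCat.{u} S} (f : Y ⟶ X) (M : ModuleCat.{u} S) (i : ℕ) :
    Ext.{u} X M i →ₗ[S] Ext.{u} Y M i :=
  (Ext.mk₀ f).precompOfLinear S M (zero_add i)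

/-- The local cohomology module `H^i_I(M)`, the direct limit over `m` of the modules
`Ext^i(S/I^m, M)` along the maps induced by the natural epimorphisms `S/I^n → S/I^m`, `m ≤ n`. -/
abbrev LocalCohomology (I : Ideal S) (M : ModuleCat.{u} S) (i : ℕ) : Type u :=
  Module.DirectLimit (fun m : ℕ => Ext.{u} (quot (I ^ m)) M i)
    (fun _ _ h => extMap (quotMap (Ideal.pow_le_pow_right h)) M i)

/-- The natural map `Θ : Ext^i(S/I, M) → H^i_I(M)`, i.e. the canonical map from the term `m = 1`
of the direct system (with `S/I` identified with `S/I^1`). -/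
def theta (I : Ideal S) (M : ModuleCat.{u} S) (i : ℕ) :
    Ext.{u} (quot I) M i →ₗ[S] LocalCohomology I M i :=
  (Module.DirectLimit.of S ℕ (fun m : ℕ => Ext.{u} (quot (I ^ m)) M i)
    (fun _ _ h => extMap (quotMap (Ideal.pow_le_pow_right h)) M i) 1) ∘ₗ
      extMap (quotMap (Ideal.pow_le_self one_ne_zero)) M i

/-- The syzygy `syz_i = F_i / im(∂_{i+1})` of a resolution `F`. -/
abbrev syz {X : ModuleCat.{u} S} (F : ProjectiveResolution X) (i : ℕ) : ModuleCat.{u} S :=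
  ModuleCat.of S (F.complex.X i ⧸ LinearMap.range (F.complex.d (i + 1) i).hom)

/-- The natural epimorphism `π : F_i → syz_i`. -/
def syzProj {X : ModuleCat.{u} S} (F : ProjectiveResolution X) (i : ℕ) :
    F.complex.X i ⟶ syz F i :=
  ModuleCat.ofHom (LinearMap.range (F.complex.d (i + 1) i).hom).mkQ

lemma d_comp_syzProj {X : ModuleCat.{u} S} (F : ProjectiveResolution X) (i : ℕ) :
    F.complex.d (i + 1) i ≫ syzProj F i = 0 := by
  ext x
  exact (Submodule.Quotient.mk_eq_zero _).2 ⟨x, rfl⟩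

/-- The class `ε = [π] ∈ Ext^i(X, syz_i)` of the cocycle `π : F_i → syz_i`. -/
def epsilon {X : ModuleCat.{u} S} (F : ProjectiveResolution X) (i : ℕ) :
    Ext.{u} X (syz F i) i :=
  F.extMk (syzProj F i) (i + 1) rfl (d_comp_syzProj F i)

/-- The canonical element `η_I ∈ H^d_I(syz_d)` of `S` with respect to the ideal `I`, computed from
the resolution `F` of `S/I`, where `d` is the dimension of `S`. -/
def eta {I : Ideal S} (F : ProjectiveResolution (quot I)) (d : ℕ) :
    LocalCohomology I (syz F d) d :=
  theta I (syz F d) d (epsilon F d)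

lemma sup_span_le_comap (q : Ideal S) (x : S) {w : ℕ} (hw : 1 ≤ w) :
    q ⊔ Ideal.span {x} ≤
      Submodule.comap (LinearMap.lsmul S S (x ^ (w - 1))) (q ⊔ Ideal.span {x ^ w}) := by
  refine sup_le (fun y hy => ?_) ?_
  · exact Ideal.mul_mem_left _ _ (Ideal.mem_sup_left hy)
  · refine (Ideal.span_singleton_le_iff_mem _).2 (Ideal.mem_sup_right ?_)
    have h : x ^ (w - 1) * x = x ^ w := by rw [← pow_succ, Nat.sub_add_cancel hw]
    change x ^ (w - 1) * x ∈ _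
    rw [h]
    exact Ideal.mem_span_singleton_self _

/-- The map `ν_w : S/(q, x) → S/(q, x^w)` given by multiplication by `x^(w-1)`. -/
def nu (q : Ideal S) (x : S) {w : ℕ} (hw : 1 ≤ w) :
    quot (q ⊔ Ideal.span {x}) ⟶ quot (q ⊔ Ideal.span {x ^ w}) :=
  ModuleCat.ofHom (Submodule.mapQ _ _ (LinearMap.lsmul S S (x ^ (w - 1)))
    (sup_span_le_comap q x hw))

/-- `E` is an injective hull of `K`: it is injective and an essential extension of (a copy
of) `K`. -/
structure IsInjectiveHull (K E : Type u) [AddCommGroup K] [Module S K] [AddCommGroup E]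
    [Module S E] : Prop where
  injective : Module.Injective S E
  essential : ∃ ι : K →ₗ[S] E, Function.Injective ι ∧
    ∀ N : Submodule S E, N ≠ ⊥ → N ⊓ LinearMap.range ι ≠ ⊥

/-- `ω` is a canonical module of the local ring `S`: it is finitely generated, and its Matlis dual
`Hom(ω, E(S/𝔪))` is isomorphic to the top local cohomology module `H^(dim S)_𝔪(S)`. -/
structure IsCanonicalModule [IsLocalRing S] (ω : ModuleCat.{u} S) : Prop where
  finite : Module.Finite S ω
  dual : ∃ (d : ℕ) (E : ModuleCat.{u} S), ringKrullDim S = d ∧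
    IsInjectiveHull (S := S) (S ⧸ IsLocalRing.maximalIdeal S) E ∧
    Nonempty ((ω →ₗ[S] E) ≃ₗ[S]
      LocalCohomology (IsLocalRing.maximalIdeal S) (ModuleCat.of S S) d)

end

end CanonicalElement

end

noncomputable section

namespace CanonicalElement

variable {S : Type u} [CommRing S]

/-! ### Functoriality of Ext in its first variable. -/

section Basic

/-! (ii) ⇔ (iii): `restrict` is an isomorphism between the local cohomologies for (q, x) and (q,
x^w), and it carries one composite to the other. (iii) ⇒ (i): every class in Ext^d(S/(q, x^w), ω) is
a pushforward of ε along a map syz_d → ω, so by naturality of Θ the vanishing of x^(w-1) η kills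
composite (iii). (i) ⇒ (iii): the point is that H^d(M), for M finitely generated, is detected by the
maps M → ω (`IsCanonicalModule.eq_zero_of_forall_map_eq_zero`). Since d = dim S, Grothendieck
vanishing makes H^d right exact on finitely generated modules, so with H^d(S) ≅ Hom(ω, E) and E
injective, H^d(M) embeds in Hom(Hom(M, ω), E). As syz_d need not be finitely generated, ε is first
descended to a finitely generated module by `exists_finite_comp_mk₀_eq`. -/

lemma extMap_apply {X Y : ModuleCat.{u} S} (f : Y ⟶ X) (M : ModuleCat.{u} S) (i : ℕ)
    (α : Ext.{u} X M i) : extMap f M i α = (Ext.mk₀ f).comp α (zero_add i) := rfl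

lemma extMap_comp {X Y Z : ModuleCat.{u} S} (f : Y ⟶ X) (g : Z ⟶ Y) (M : ModuleCat.{u} S) (i : ℕ)
    (α : Ext.{u} X M i) : extMap (g ≫ f) M i α = extMap g M i (extMap f M i α) := by
  simp only [extMap_apply, Ext.mk₀_comp_mk₀_assoc]

lemma extMap_id {X : ModuleCat.{u} S} (M : ModuleCat.{u} S) (i : ℕ)
    (α : Ext.{u} X M i) : extMap (𝟙 X) M i α = α := by
  simp only [extMap_apply, Ext.mk₀_id_comp]

lemma extMap_comp_mk₀ {X Y M M' : ModuleCat.{u} S} (f : Y ⟶ X) (i : ℕ)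
    (α : Ext.{u} X M i) (φ : M ⟶ M') :
    extMap f M' i (α.comp (Ext.mk₀ φ) (add_zero i)) =
      (extMap f M i α).comp (Ext.mk₀ φ) (add_zero i) := by
  simp only [extMap_apply]
  rw [Ext.comp_assoc_of_third_deg_zero]

lemma extMap_comp_ext {X Y M M' : ModuleCat.{u} S} (f : Y ⟶ X) {i j k : ℕ}
    (α : Ext.{u} X M i) (β : Ext.{u} M M' j) (h : i + j = k) :
    extMap f M' k (α.comp β h) = (extMap f M i α).comp β h := by
  simp only [extMap_apply]
  rw [Ext.comp_assoc _ _ _ (zero_add i) h (by lia)]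

lemma quotMap_comp {K J I : Ideal S} (h : K ≤ J) (h' : J ≤ I) :
    quotMap h ≫ quotMap h' = quotMap (h.trans h') := by
  ext
  rfl

lemma quotMap_refl (I : Ideal S) : quotMap (le_refl I) = 𝟙 (quot I) := by
  ext
  rfl

lemma extMap_quotMap {K J I : Ideal S} (h : K ≤ J) (h' : J ≤ I) (M : ModuleCat.{u} S) (i : ℕ)
    (α : Ext.{u} (quot I) M i) :
    extMap (quotMap h) M i (extMap (quotMap h') M i α) = extMap (quotMap (h.trans h')) M i α := by
  rw [← extMap_comp, quotMap_comp]

instance (I : Ideal S) (M : ModuleCat.{u} S) (i : ℕ) :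
    DirectedSystem (fun m : ℕ => Ext.{u} (quot (I ^ m)) M i)
      (fun _ _ h => extMap (quotMap (Ideal.pow_le_pow_right h)) M i) where
  map_self m α := by
    change extMap (quotMap le_rfl) M i α = α
    rw [quotMap_refl, extMap_id]
  map_map _ _ _ _ _ α := extMap_quotMap _ _ M i α

end Basic

/-! ### Local cohomology as a functor, and its long exact sequence. -/

namespace LocalCohomology

variable (I : Ideal S) (M : ModuleCat.{u} S) (i : ℕ)

/-- The canonical map from the `m`-th term of the direct system to local cohomology. -/
def of (m : ℕ) : Ext.{u} (quot (I ^ m)) M i →ₗ[S] LocalCohomology I M i :=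
  Module.DirectLimit.of S ℕ (fun m : ℕ => Ext.{u} (quot (I ^ m)) M i)
    (fun _ _ h => extMap (quotMap (Ideal.pow_le_pow_right h)) M i) m

variable {I M i}

lemma of_extMap {m n : ℕ} (h : m ≤ n) (h' : I ^ n ≤ I ^ m) (α : Ext.{u} (quot (I ^ m)) M i) :
    of I M i n (extMap (quotMap h') M i α) = of I M i m α :=
  Module.DirectLimit.of_f (R := S) (ι := ℕ) (G := fun m : ℕ => Ext.{u} (quot (I ^ m)) M i)
    (f := fun _ _ h => extMap (quotMap (Ideal.pow_le_pow_right h)) M i) (hij := h) (x := α)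

lemma exists_of (z : LocalCohomology I M i) : ∃ m α, of I M i m α = z :=
  Module.DirectLimit.exists_of z

lemma of_eq_zero {m : ℕ} {α : Ext.{u} (quot (I ^ m)) M i} (h : of I M i m α = 0) :
    ∃ n, ∃ h : m ≤ n, extMap (quotMap (Ideal.pow_le_pow_right h)) M i α = 0 :=
  Module.DirectLimit.of.zero_exact h

lemma theta_apply (α : Ext.{u} (quot I) M i) :
    theta I M i α = of I M i 1 (extMap (quotMap (Ideal.pow_le_self one_ne_zero)) M i α) := rfl

variable (I i) in
/-- The map on local cohomology induced by a morphism of modules. -/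
def map {M M' : ModuleCat.{u} S} (φ : M ⟶ M') :
    LocalCohomology I M i →ₗ[S] LocalCohomology I M' i :=
  Module.DirectLimit.map (fun m => (Ext.mk₀ φ).postcompOfLinear S (quot (I ^ m)) (add_zero i))
    (fun _ _ _ => LinearMap.ext fun α => (extMap_comp_mk₀ _ i α φ).symm)

@[simp]
lemma map_of {M M' : ModuleCat.{u} S} (φ : M ⟶ M') (m : ℕ) (α : Ext.{u} (quot (I ^ m)) M i) :
    map I i φ (of I M i m α) = of I M' i m (α.comp (Ext.mk₀ φ) (add_zero i)) :=
  Module.DirectLimit.map_apply_of (R := S) (ι := ℕ)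
    (G := fun m : ℕ => Ext.{u} (quot (I ^ m)) M i)
    (f := fun _ _ h => extMap (quotMap (Ideal.pow_le_pow_right h)) M i)
    (G' := fun m : ℕ => Ext.{u} (quot (I ^ m)) M' i)
    (f' := fun _ _ h => extMap (quotMap (Ideal.pow_le_pow_right h)) M' i)
    (fun m => (Ext.mk₀ φ).postcompOfLinear S (quot (I ^ m)) (add_zero i))
    (fun _ _ _ => LinearMap.ext fun α => (extMap_comp_mk₀ _ i α φ).symm) α

lemma map_theta {M M' : ModuleCat.{u} S} (φ : M ⟶ M') (α : Ext.{u} (quot I) M i) :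
    map I i φ (theta I M i α) = theta I M' i (α.comp (Ext.mk₀ φ) (add_zero i)) := by
  rw [theta_apply, map_of, theta_apply, extMap_comp_mk₀]

variable (S) in
/-- Local cohomology as a functor. -/
def functor (I : Ideal S) (i : ℕ) : ModuleCat.{u} S ⥤ ModuleCat.{u} S where
  obj M := ModuleCat.of S (LocalCohomology I M i)
  map φ := ModuleCat.ofHom (map I i φ)
  map_id M := by
    refine ModuleCat.hom_ext (LinearMap.ext fun z => ?_)
    obtain ⟨m, α, rfl⟩ := exists_of z
    simp
  map_comp φ ψ := by
    refine ModuleCat.hom_ext (LinearMap.ext fun z => ?_)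
    obtain ⟨m, α, rfl⟩ := exists_of z
    simp [← Ext.mk₀_comp_mk₀]

instance : (functor S I i).Additive where
  map_add {M M' φ ψ} := by
    refine ModuleCat.hom_ext (LinearMap.ext fun z => ?_)
    obtain ⟨m, α, rfl⟩ := exists_of z
    change map I i (φ + ψ) (of I M i m α) = map I i φ (of I M i m α) + map I i ψ (of I M i m α)
    rw [map_of, map_of, map_of, Ext.mk₀_add, Ext.comp_add, map_add]

instance : (functor S I i).Linear S where
  map_smul φ r := by
    refine ModuleCat.hom_ext (LinearMap.ext fun z => ?_)
    obtain ⟨m, α, rfl⟩ := exists_of z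
    change map I i (r • φ) (of I _ i m α) = r • map I i φ (of I _ i m α)
    rw [map_of, map_of, Ext.mk₀_smul, Ext.comp_smul, map_smul]

/-- This and the next two lemmas are fragments of the long exact sequence: a vanishing in the limit
already holds at a finite stage, where the Ext sequence applies. -/
lemma map_exact {C : ShortComplex (ModuleCat.{u} S)} (hC : C.ShortExact)
    {z : LocalCohomology I C.X₂ i} (hz : map I i C.g z = 0) : ∃ y, map I i C.f y = z := by
  obtain ⟨m, α, rfl⟩ := exists_of z
  rw [map_of] at hz
  obtain ⟨n, hn, h⟩ := of_eq_zero hz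
  rw [extMap_comp_mk₀] at h
  obtain ⟨β, hβ⟩ := Ext.covariant_sequence_exact₂ _ hC _ h
  exact ⟨of I _ i n β, by rw [map_of, hβ, of_extMap hn]⟩

lemma map_surjective {C : ShortComplex (ModuleCat.{u} S)} (hC : C.ShortExact)
    (h : Subsingleton (LocalCohomology I C.X₁ (i + 1))) : Function.Surjective (map I i C.g) := by
  intro z
  obtain ⟨m, α, rfl⟩ := exists_of z
  obtain ⟨n, hn, h⟩ := of_eq_zero
    (Subsingleton.elim (of I C.X₁ (i + 1) m (α.comp hC.extClass rfl)) 0)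
  rw [extMap_comp_ext] at h
  obtain ⟨β, hβ⟩ := Ext.covariant_sequence_exact₃ _ hC _ _ h
  exact ⟨of I _ i n β, by rw [map_of, hβ, of_extMap hn]⟩

lemma map_injective {C : ShortComplex (ModuleCat.{u} S)} (hC : C.ShortExact)
    (h : Subsingleton (LocalCohomology I C.X₃ i)) : Function.Injective (map I (i + 1) C.f) := by
  rw [injective_iff_map_eq_zero]
  intro z hz
  obtain ⟨m, α, rfl⟩ := exists_of z
  rw [map_of] at hz
  obtain ⟨n, hn, hα⟩ := of_eq_zero hz
  rw [extMap_comp_mk₀] at hα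
  obtain ⟨β, hβ⟩ := Ext.covariant_sequence_exact₁ _ hC _ hα rfl
  obtain ⟨k, hk, hβ'⟩ := of_eq_zero (Subsingleton.elim (of I C.X₃ i n β) 0)
  rw [← of_extMap hn (Ideal.pow_le_pow_right hn), ← hβ, ← of_extMap hk (Ideal.pow_le_pow_right hk),
    extMap_comp_ext, hβ', Ext.zero_comp, map_zero]

/-! ### Comparison of the local cohomologies of nested ideals. -/

section Restrict

variable {J : Ideal S} (h : I ≤ J)

variable (M i) in
/-- The natural map `H^i_J(M) → H^i_I(M)` for `I ≤ J`. -/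
def restrict : LocalCohomology J M i →ₗ[S] LocalCohomology I M i :=
  Module.DirectLimit.lift S ℕ _ _
    (fun m => of I M i m ∘ₗ extMap (quotMap (Ideal.pow_right_mono h m)) M i) (by
      intro m n hmn α
      simp only [LinearMap.comp_apply]
      rw [extMap_quotMap, ← of_extMap hmn (Ideal.pow_le_pow_right hmn) (extMap _ M i α),
        extMap_quotMap])

lemma restrict_of (m : ℕ) (α : Ext.{u} (quot (J ^ m)) M i) :
    restrict M i h (of J M i m α) =
      of I M i m (extMap (quotMap (Ideal.pow_right_mono h m)) M i α) :=
  Module.DirectLimit.lift_of ..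

lemma restrict_theta (α : Ext.{u} (quot J) M i) :
    restrict M i h (theta J M i α) = theta I M i (extMap (quotMap h) M i α) := by
  rw [theta_apply, restrict_of, theta_apply, extMap_quotMap, extMap_quotMap]

lemma restrict_bijective {k : ℕ} (hk : J ^ k ≤ I) : Function.Bijective (restrict M i h) := by
  -- The factor k + 1, rather than k, ensures n ≤ (k + 1) * n even when k = 0.
  have key (n : ℕ) : J ^ ((k + 1) * n) ≤ I ^ n := by
    rw [pow_mul]
    exact Ideal.pow_right_mono ((Ideal.pow_le_pow_right k.le_succ).trans hk) n
  constructor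
  · rw [injective_iff_map_eq_zero]
    intro z hz
    obtain ⟨m, α, rfl⟩ := exists_of z
    rw [restrict_of] at hz
    obtain ⟨n, hn, hα⟩ := of_eq_zero hz
    have hmn : m ≤ (k + 1) * n := hn.trans (Nat.le_mul_of_pos_left n k.succ_pos)
    rw [← of_extMap hmn (Ideal.pow_le_pow_right hmn)]
    have := congrArg (extMap (quotMap (key n)) M i) hα
    rw [extMap_quotMap, extMap_quotMap, map_zero] at this
    rw [this, map_zero]
  · intro z
    obtain ⟨m, α, rfl⟩ := exists_of z
    have hm : m ≤ (k + 1) * m := Nat.le_mul_of_pos_left m k.succ_pos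
    refine ⟨of J M i ((k + 1) * m) (extMap (quotMap (key m)) M i α), ?_⟩
    rw [restrict_of, extMap_quotMap, of_extMap hm]

end Restrict

end LocalCohomology

/-! ### Grothendieck vanishing. -/

section Vanishing

lemma extMap_extClass_comp {C C' : ShortComplex (ModuleCat.{u} S)} (hC : C.ShortExact)
    (hC' : C'.ShortExact) (φ : C' ⟶ C) {M : ModuleCat.{u} S} {j k : ℕ} (h : 1 + j = k)
    (γ : Ext.{u} C.X₁ M j) :
    extMap φ.τ₃ M k (hC.extClass.comp γ h) = hC'.extClass.comp (extMap φ.τ₁ M j γ) h := by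
  rw [extMap_comp_ext, extMap_apply, extMap_apply, ← ShortComplex.ShortExact.extClass_naturality
    hC' hC φ, Ext.comp_assoc _ _ _ (add_zero 1) (zero_add j) (by lia)]

/-- The inclusion of a submodule as a morphism of modules. -/
abbrev subtypeHom {K : ModuleCat.{u} S} (N : Submodule S K) : ModuleCat.of S N ⟶ K :=
  ModuleCat.ofHom N.subtype

lemma extMap_eq_zero_of_factors {X K : ModuleCat.{u} S} (N : Submodule S K) (f : X ⟶ K)
    (hf : ∀ x, f x ∈ N) {M : ModuleCat.{u} S} {j : ℕ} {γ : Ext.{u} K M j}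
    (hγ : extMap (subtypeHom N) M j γ = 0) : extMap f M j γ = 0 := by
  have : f = ModuleCat.ofHom (f.hom.codRestrict N hf) ≫ subtypeHom N := by
    ext x
    rfl
  rw [this, extMap_comp, hγ, map_zero]

/-- Dimension shifting with Artin–Rees: for a finite free P → K with kernel L, the intersection of
I^(n+c) P with L lies in I^n L, where the shifted class already dies. -/
lemma exists_extMap_pow_smul_top_eq_zero [IsNoetherianRing S] (I : Ideal S) (M : ModuleCat.{u} S)
    {k : ℕ} (hM : ∀ r ∈ I ^ k, ∀ m : M, r • m = 0) (j : ℕ) :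
    ∀ (K : ModuleCat.{u} S) [Module.Finite S K] (β : Ext.{u} K M j),
      ∃ n, extMap (subtypeHom (I ^ n • ⊤ : Submodule S K)) M j β = 0 := by
  induction j with
  | zero =>
    intro K _ β
    obtain ⟨f, rfl⟩ := Ext.homEquiv₀.symm.surjective β
    refine ⟨k, ?_⟩
    change (Ext.mk₀ _).comp (Ext.mk₀ f) (zero_add 0) = 0
    rw [Ext.mk₀_comp_mk₀, Ext.mk₀_eq_zero_iff]
    ext ⟨x, hx⟩
    change f.hom x = 0
    refine Submodule.smul_induction_on hx (fun r hr y _ => ?_) (fun y y' hy hy' => ?_)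
    · rw [map_smul, hM r hr]
    · rw [map_add, hy, hy', add_zero]
  | succ j ih =>
    intro K _ β
    obtain ⟨P, _, _, _, _, f, hf⟩ := Module.exists_finite_presentation S K
    have hC := LinearMap.shortExact_shortComplexKer hf
    obtain ⟨γ, rfl⟩ := precomp_extClass_surjective_of_projective_X₂ M hC j β
    obtain ⟨n, hn⟩ := ih (ModuleCat.of S (LinearMap.ker f)) γ
    obtain ⟨c, hc⟩ := I.exists_pow_inf_eq_pow_smul (LinearMap.ker f)
    have hmap : (I ^ (n + c) • ⊤ : Submodule S P).map f = I ^ (n + c) • ⊤ := by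
      rw [Submodule.map_smul'', Submodule.map_top, LinearMap.range_eq_top.2 hf]
    have hmem (x : P) (hx : x ∈ (I ^ (n + c) • ⊤ : Submodule S P)) :
        f x ∈ (I ^ (n + c) • ⊤ : Submodule S K) := hmap ▸ Submodule.mem_map_of_mem hx
    let f' := f.restrict hmem
    have hf' : Function.Surjective f' := by
      rintro ⟨y, hy⟩
      rw [← hmap] at hy
      obtain ⟨x, hx, rfl⟩ := hy
      exact ⟨⟨x, hx⟩, rfl⟩
    have hC' := LinearMap.shortExact_shortComplexKer hf'
    have hker (x : LinearMap.ker f') : f (x.1 : P) = 0 := congrArg Subtype.val x.2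
    let t : LinearMap.ker f' →ₗ[S] LinearMap.ker f :=
      ((I ^ (n + c) • ⊤ : Submodule S P).subtype ∘ₗ (LinearMap.ker f').subtype).codRestrict _ hker
    let φ : f'.shortComplexKer ⟶ f.shortComplexKer :=
      { τ₁ := ModuleCat.ofHom t
        τ₂ := ModuleCat.ofHom (Submodule.subtype _)
        τ₃ := ModuleCat.ofHom (Submodule.subtype _) }
    refine ⟨n + c, ?_⟩
    have := extMap_extClass_comp hC hC' φ (add_comm 1 j) γ
    rw [extMap_eq_zero_of_factors _ φ.τ₁ (fun x => ?_) hn, Ext.comp_zero] at this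
    · exact this
    · have hx : ((x : LinearMap.ker f').1 : P) ∈ I ^ (n + c) • ⊤ ⊓ LinearMap.ker f :=
        ⟨x.1.2, hker x⟩
      rw [hc _ (Nat.le_add_left c n), Nat.add_sub_cancel] at hx
      exact (Submodule.mem_smul_top_iff _ _ (t x)).2 (Submodule.smul_mono le_rfl inf_le_right hx)

namespace LocalCohomology

variable {I : Ideal S} {M : ModuleCat.{u} S} {i : ℕ}

/-- A class of positive degree on S/I^m comes from a class on I^m, which dies on I^n I^m = I^(n+m)
for some n. -/
lemma subsingleton_of_pow_smul_eq_zero [IsNoetherianRing S] {k : ℕ}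
    (hM : ∀ r ∈ I ^ k, ∀ m : M, r • m = 0) : Subsingleton (LocalCohomology I M (i + 1)) := by
  refine subsingleton_of_forall_eq 0 fun z => ?_
  obtain ⟨m, α, rfl⟩ := exists_of z
  have hC (l : ℕ) := LinearMap.shortExact_shortComplexKer (I ^ l).mkQ_surjective
  obtain ⟨β, rfl⟩ := precomp_extClass_surjective_of_projective_X₂ M (hC m) i α
  obtain ⟨n, hn⟩ := exists_extMap_pow_smul_top_eq_zero I M hM i
    (ModuleCat.of S (LinearMap.ker (I ^ m).mkQ)) β
  have hmn : m ≤ n + m := Nat.le_add_left m n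
  have hle : LinearMap.ker (I ^ (n + m)).mkQ ≤ LinearMap.ker (I ^ m).mkQ := by
    simpa using Ideal.pow_le_pow_right hmn
  let φ : (I ^ (n + m)).mkQ.shortComplexKer ⟶ (I ^ m).mkQ.shortComplexKer :=
    { τ₁ := ModuleCat.ofHom (Submodule.inclusion hle)
      τ₂ := 𝟙 _
      τ₃ := quotMap (Ideal.pow_le_pow_right hmn) }
  have := extMap_extClass_comp (hC m) (hC (n + m)) φ (add_comm 1 i) β
  rw [extMap_eq_zero_of_factors _ φ.τ₁ (fun x => ?_) hn, Ext.comp_zero] at this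
  · rw [← of_extMap hmn (Ideal.pow_le_pow_right hmn)]
    exact (congrArg (of I M (i + 1) (n + m)) this).trans (map_zero _)
  · refine (Submodule.mem_smul_top_iff _ _ (Submodule.inclusion hle x)).2 ?_
    have hx : (x.1 : S) ∈ I ^ (n + m) := (Submodule.Quotient.mk_eq_zero _).1 x.2
    have hm : I ^ m ≤ LinearMap.ker (I ^ m).mkQ := (Submodule.ker_mkQ _).ge
    exact Submodule.smul_mono le_rfl hm ((pow_add I n m).le hx)

lemma subsingleton_of_subsingleton [Subsingleton M] : Subsingleton (LocalCohomology I M i) := by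
  refine subsingleton_of_forall_eq 0 fun z => ?_
  obtain ⟨m, α, rfl⟩ := exists_of z
  have : 𝟙 M = 0 := by
    ext x
    exact Subsingleton.elim _ _
  rw [← Ext.comp_mk₀_id α, this, Ext.mk₀_zero, Ext.comp_zero, map_zero]

lemma exists_pow_smul_eq_zero {y : S} (hy : y ∈ I) (z : LocalCohomology I M i) :
    ∃ m, y ^ m • z = 0 := by
  obtain ⟨m, α, rfl⟩ := exists_of z
  refine ⟨m, ?_⟩
  have h0 : y ^ m • 𝟙 (quot (I ^ m)) = 0 := by
    refine ModuleCat.hom_ext (LinearMap.ext fun x => ?_)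
    obtain ⟨x, rfl⟩ := Submodule.Quotient.mk_surjective _ x
    change Submodule.Quotient.mk (y ^ m • x) = 0
    rw [Submodule.Quotient.mk_eq_zero]
    exact Ideal.mul_mem_right _ _ (Ideal.pow_mem_pow hy m)
  rw [← map_smul, ← Ext.mk₀_id_comp α, ← Ext.smul_comp, ← Ext.mk₀_smul, h0, Ext.mk₀_zero,
    Ext.zero_comp, map_zero]

lemma map_smul_id (y : S) (z : LocalCohomology I M i) : map I i (y • 𝟙 M) z = y • z := by
  obtain ⟨m, α, rfl⟩ := exists_of z
  rw [map_of, Ext.mk₀_smul, Ext.comp_smul, Ext.comp_mk₀_id, map_smul]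

/-- The long exact sequence makes y act injectively, while every element is killed by a power of y.
-/
lemma subsingleton_succ_of_isSMulRegular {y : S} (hy : y ∈ I) (hreg : IsSMulRegular M y)
    (h : Subsingleton (LocalCohomology I (ModuleCat.of S (QuotSMulTop y M)) i)) :
    Subsingleton (LocalCohomology I M (i + 1)) := by
  have hinj := map_injective (I := I) (i := i) hreg.smulShortComplex_shortExact h
  refine subsingleton_of_forall_eq 0 fun z => ?_
  obtain ⟨m, hm⟩ := exists_pow_smul_eq_zero hy z
  have hreg' : Function.Injective (fun z : LocalCohomology I M (i + 1) => y • z) := by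
    intro z z' hz
    apply hinj
    change map I (i + 1) (y • 𝟙 M) z = map I (i + 1) (y • 𝟙 M) z'
    rwa [map_smul_id, map_smul_id]
  exact (IsSMulRegular.pow m (hreg' : IsSMulRegular _ y)).right_eq_zero_of_smul hm

end LocalCohomology

/-- N is the stable value of the I^k-torsion. No nonzero element of M/N is killed by I, so prime
avoidance over the associated primes yields y. -/
lemma exists_torsion_quotient_isSMulRegular [IsNoetherianRing S] (I : Ideal S) (M : Type u)
    [AddCommGroup M] [Module S M] [Module.Finite S M] :
    ∃ (N : Submodule S M) (k : ℕ) (y : S), (∀ r ∈ I ^ k, ∀ m : N, r • m = 0) ∧ y ∈ I ∧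
      IsSMulRegular (M ⧸ N) y := by
  let T : ℕ →o Submodule S M :=
    { toFun k := Submodule.torsionBySet S M (I ^ k : Ideal S)
      monotone' k l h := Submodule.torsionBySet_le_torsionBySet_of_subset
        (Ideal.pow_le_pow_right h) }
  obtain ⟨k, hk⟩ := monotone_stabilizes_iff_noetherian.2 inferInstance T
  have hmem (l : ℕ) (x : M) : x ∈ T l ↔ ∀ r ∈ I ^ l, r • x = 0 := by
    change x ∈ Submodule.torsionBySet S M _ ↔ _
    simp [Submodule.mem_torsionBySet_iff]
  have hT (x : M) (hx : ∀ r ∈ I, r • x ∈ T k) : x ∈ T k := by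
    rw [hk (k + 1) k.le_succ, hmem, pow_succ]
    intro r hr
    refine Submodule.mul_induction_on hr (fun a ha b hb => ?_) (fun a b ha hb => ?_)
    · rw [mul_smul]
      exact (hmem k _).1 (hx b hb) a ha
    · rw [add_smul, ha, hb, add_zero]
  have hI : ¬ ((I : Set S) ⊆ ⋃ p ∈ associatedPrimes S (M ⧸ T k), (id p : Ideal S)) := by
    rw [Ideal.subset_union_prime_finite (f := id) (associatedPrimes.finite S (M ⧸ T k)) ⊥ ⊥
      (fun p hp _ _ => hp.1)]
    rintro ⟨p, hp, hIp⟩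
    obtain ⟨hprime, x, hx⟩ := (Submodule.isAssociatedPrime_iff).1 hp
    obtain ⟨x, rfl⟩ := Submodule.Quotient.mk_surjective _ x
    refine hprime.ne_top ((Ideal.eq_top_iff_one _).2 ?_)
    have : x ∈ T k := hT x fun r hr => by
      have := hIp hr
      rw [id, hx, Submodule.mem_colon_singleton, Submodule.mem_bot,
        ← Submodule.Quotient.mk_smul, Submodule.Quotient.mk_eq_zero] at this
      exact this
    rw [hx, Submodule.mem_colon_singleton, one_smul, Submodule.mem_bot]
    exact (Submodule.Quotient.mk_eq_zero _).2 this
  obtain ⟨y, hy, hy'⟩ := Set.not_subset.1 hI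
  refine ⟨T k, k, y, fun r hr m => Subtype.ext ((hmem k m).1 m.2 r hr), hy, ?_⟩
  simp only [id] at hy'
  rw [biUnion_associatedPrimes_eq_compl_regular] at hy'
  simpa using hy'

namespace LocalCohomology

/-- Grothendieck vanishing. -/
theorem subsingleton_of_supportDim_lt [IsNoetherianRing S] (I : Ideal S) (n : ℕ) :
    ∀ (M : ModuleCat.{u} S) [Module.Finite S M], Module.supportDim S M < n →
      Subsingleton (LocalCohomology I M n) := by
  induction n with
  | zero =>
    intro M _ h
    have : Module.supportDim S M = ⊥ := by
      by_contra hne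
      have := (Module.supportDim_ne_bot_iff_nontrivial S M).1 hne
      have hne' : Nonempty (Module.support S M) :=
        Module.nonempty_support_of_nontrivial.to_subtype
      exact absurd h (not_lt.2 (Order.krullDim_nonneg))
    have := (Module.supportDim_eq_bot_iff_subsingleton S M).1 this
    exact subsingleton_of_subsingleton
  | succ n ih =>
    intro M _ h
    obtain ⟨N, k, y, hN, hy, hreg⟩ := exists_torsion_quotient_isSMulRegular I M
    have hle : Module.supportDim S (M ⧸ N) ≤ Module.supportDim S M :=
      Module.supportDim_le_of_surjective N.mkQ N.mkQ_surjective
    -- A regular element lies outside the minimal primes of the support, so the dimension drops by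
    -- one.
    have hle' := Module.supportDim_quotSMulTop_succ_le_of_notMem_minimalPrimes
      (M := M ⧸ N) (fun _ => hreg.notMem_of_mem_minimalPrimes)
    have hlt : Module.supportDim S (QuotSMulTop y (M ⧸ N)) < n := by
      have := (hle'.trans hle).trans_lt h
      push_cast at this
      exact lt_of_add_lt_add_right this
    have hsub := subsingleton_succ_of_isSMulRegular (M := ModuleCat.of S (M ⧸ N)) hy hreg
      (ih (ModuleCat.of S (QuotSMulTop y (M ⧸ N))) hlt)
    have hsub' : Subsingleton (LocalCohomology I (ModuleCat.of S (LinearMap.ker N.mkQ)) (n + 1)) :=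
      subsingleton_of_pow_smul_eq_zero (k := k) fun r hr m => by
        have hm : m.1 ∈ N := (Submodule.Quotient.mk_eq_zero _).1 m.2
        exact Subtype.ext (congrArg Subtype.val (hN r hr ⟨m.1, hm⟩) :)
    refine subsingleton_of_forall_eq 0 fun z => ?_
    obtain ⟨y, rfl⟩ := map_exact (LinearMap.shortExact_shortComplexKer N.mkQ_surjective)
      (Subsingleton.elim (map I (n + 1) (ModuleCat.ofHom N.mkQ) z) 0)
    exact (congrArg _ (hsub'.elim y 0)).trans (map_zero _)

end LocalCohomology

end Vanishing

/-! ### Duality for right exact functors on finitely generated modules. -/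

section Duality

/-- A functor is right exact on finitely generated modules. -/
structure IsRightExactOnFinite (T : ModuleCat.{u} S ⥤ ModuleCat.{u} S) : Prop where
  surjective : ∀ {P M : ModuleCat.{u} S} (f : P ⟶ M) [Module.Finite S P],
    Function.Surjective f → Function.Surjective (T.map f)
  exact : ∀ {Q P M : ModuleCat.{u} S} (g : Q ⟶ P) (f : P ⟶ M) [Module.Finite S Q]
    [Module.Finite S P], Function.Exact g f → Function.Surjective f →
    ∀ z, T.map f z = 0 → ∃ y, T.map g y = z

variable (T : ModuleCat.{u} S ⥤ ModuleCat.{u} S)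
  {ω E : Type u} [AddCommGroup ω] [Module S ω] [AddCommGroup E] [Module S E]
  (θ : T.obj (ModuleCat.of S S) ≃ₗ[S] (ω →ₗ[S] E))

/-- The free module of rank `n`. -/
abbrev freeModule (S : Type u) [CommRing S] (n : ℕ) : ModuleCat.{u} S :=
  ModuleCat.of S (Fin n → S)

/-- The `j`-th coordinate projection. -/
abbrev freeProj (S : Type u) [CommRing S] {n : ℕ} (j : Fin n) :
    freeModule S n ⟶ ModuleCat.of S S :=
  ModuleCat.ofHom (LinearMap.proj j)

/-- The `j`-th coordinate inclusion. -/
abbrev freeSingle (S : Type u) [CommRing S] {n : ℕ} (j : Fin n) :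
    ModuleCat.of S S ⟶ freeModule S n :=
  ModuleCat.ofHom (LinearMap.single S (fun _ => S) j)

/-- The pairing of `T(S^n)` with `Hom(S^n, ω)` induced by an isomorphism `T(S) ≃ Hom(ω, E)`. -/
def freePairing (n : ℕ) : T.obj (freeModule S n) →ₗ[S] ((Fin n → S) →ₗ[S] ω) →ₗ[S] E :=
  ∑ j : Fin n, (LinearMap.lcomp S E (LinearMap.applyₗ (R := S) (Pi.single j (1 : S)))) ∘ₗ
    θ.toLinearMap ∘ₗ (T.map (freeProj S j)).hom

lemma freePairing_apply {n : ℕ} (h : T.obj (freeModule S n)) (a : (Fin n → S) →ₗ[S] ω) :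
    freePairing T θ n h a = ∑ j, θ (T.map (freeProj S j) h) (a (Pi.single j 1)) := by
  simp [freePairing, LinearMap.sum_apply]

lemma map_map_apply {X Y Z : ModuleCat.{u} S} (f : X ⟶ Y) (g : Y ⟶ Z) (h : T.obj X) :
    T.map g (T.map f h) = T.map (f ≫ g) h := by
  rw [T.map_comp]
  rfl

lemma linearMap_pi_apply {n : ℕ} {N : Type u} [AddCommGroup N] [Module S N]
    (g : (Fin n → S) →ₗ[S] N) (v : Fin n → S) : g v = ∑ j, v j • g (Pi.single j 1) := by
  conv_lhs => rw [pi_eq_sum_univ' v]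
  simp [map_sum, map_smul]

variable [T.Linear S]

lemma freePairing_surjective (n : ℕ) : Function.Surjective (freePairing T θ n) := by
  intro Ψ
  -- ψ k sends u to the value of Ψ at the map v ↦ v_k u; such maps generate Hom(S^n, ω).
  let ψ (k : Fin n) : ω →ₗ[S] E :=
    Ψ ∘ₗ LinearMap.lcomp S ω (LinearMap.proj k) ∘ₗ (LinearMap.ringLmapEquivSelf S S ω).symm
  refine ⟨∑ k, T.map (freeSingle S k) (θ.symm (ψ k)), LinearMap.ext fun a => ?_⟩
  have hkj (k j : Fin n) : freeSingle S k ≫ freeProj S j = (if k = j then (1 : S) else 0) • 𝟙 _ := by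
    refine ModuleCat.hom_ext (LinearMap.ext fun v => ?_)
    change (Pi.single k v : Fin n → S) j = (if k = j then (1 : S) else 0) * v
    rw [Pi.single_apply]
    split_ifs <;> simp_all
  have hT (k j : Fin n) (t : T.obj (ModuleCat.of S S)) :
      T.map (freeProj S j) (T.map (freeSingle S k) t) = (if k = j then (1 : S) else 0) • t := by
    rw [map_map_apply, hkj, T.map_smul, T.map_id]
    rfl
  rw [freePairing_apply]
  simp only [map_sum, hT, LinearEquiv.apply_symm_apply, ite_smul, one_smul, zero_smul,
    Finset.sum_ite_eq', Finset.mem_univ, if_true]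
  simp only [ψ, LinearMap.comp_apply]
  rw [← map_sum]
  congr 1
  refine LinearMap.ext fun v => ?_
  rw [linearMap_pi_apply a v, LinearMap.sum_apply]
  exact Finset.sum_congr rfl fun j _ => rfl

variable [T.Additive]

lemma map_sum_smul_apply {X Y : ModuleCat.{u} S} {n : ℕ} (c : Fin n → S) (f : Fin n → (X ⟶ Y))
    (h : T.obj X) : T.map (∑ j, c j • f j) h = ∑ j, c j • T.map (f j) h := by
  rw [T.map_sum]
  change (ModuleCat.Hom.hom (∑ j, T.map (c j • f j) : T.obj X ⟶ T.obj Y)) h = _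
  rw [ModuleCat.hom_sum, LinearMap.sum_apply]
  simp_rw [T.map_smul]
  rfl

lemma freePairing_map {n r : ℕ} (g : (Fin n → S) →ₗ[S] (Fin r → S)) (h : T.obj (freeModule S n))
    (b : (Fin r → S) →ₗ[S] ω) :
    freePairing T θ r (T.map (X := freeModule S n) (Y := freeModule S r) (ModuleCat.ofHom g) h) b =
      freePairing T θ n h (b ∘ₗ g) := by
  have key (k : Fin r) : (ModuleCat.ofHom g : freeModule S n ⟶ freeModule S r) ≫ freeProj S k =
      ∑ j, g (Pi.single j 1) k • freeProj S j := by
    refine ModuleCat.hom_ext (LinearMap.ext fun v => ?_)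
    rw [ModuleCat.hom_sum, LinearMap.sum_apply]
    change g v k = ∑ j, g (Pi.single j 1) k * v j
    rw [linearMap_pi_apply g v, Finset.sum_apply]
    exact Finset.sum_congr rfl fun j _ => mul_comm _ _
  simp only [freePairing_apply, map_map_apply, key, map_sum_smul_apply, map_sum, map_smul,
    LinearMap.sum_apply, LinearMap.smul_apply, LinearMap.comp_apply]
  rw [Finset.sum_comm]
  refine Finset.sum_congr rfl fun j _ => ?_
  rw [linearMap_pi_apply b (g (Pi.single j 1)), map_sum]
  simp only [map_smul]

lemma freePairing_injective (n : ℕ) : Function.Injective (freePairing T θ n) := by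
  rw [injective_iff_map_eq_zero]
  intro h hh
  have hid : 𝟙 (freeModule S n) = ∑ j, (1 : S) • (freeProj S j ≫ freeSingle S j) := by
    refine ModuleCat.hom_ext (LinearMap.ext fun v => ?_)
    rw [ModuleCat.hom_sum, LinearMap.sum_apply]
    simp only [one_smul]
    exact (LinearMap.sum_single_apply _ v).symm
  have hj (j : Fin n) : T.map (freeProj S j) h = 0 := by
    refine θ.injective (LinearMap.ext fun x => ?_)
    -- The test map v ↦ v_j x isolates the j-th coordinate.
    have := LinearMap.congr_fun hh ((LinearMap.toSpanSingleton S ω x) ∘ₗ LinearMap.proj j)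
    rw [freePairing_apply, Finset.sum_eq_single j] at this
    · simpa using this
    · intro k _ hk
      simp [Pi.single_eq_of_ne hk.symm]
    · simp
  have : h = T.map (𝟙 (freeModule S n)) h := by
    rw [T.map_id]
    rfl
  rw [this, hid, map_sum_smul_apply]
  simp only [← map_map_apply, hj, map_zero, smul_zero, Finset.sum_const_zero]

variable {T}

/-- The pairing depends only on T(a)(h). Lift a to g through a free cover b of ω; then T(g)(h) comes
from the relations of b, on which b vanishes. -/
lemma freePairing_eq_zero [IsNoetherianRing S] [Module.Finite S ω] (hT : IsRightExactOnFinite T)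
    {n : ℕ} {h : T.obj (freeModule S n)} {a : (Fin n → S) →ₗ[S] ω}
    (ha : T.map (X := freeModule S n) (Y := ModuleCat.of S ω) (ModuleCat.ofHom a) h = 0) :
    freePairing T θ n h a = 0 := by
  obtain ⟨r, b, hb⟩ := Module.Finite.exists_fin' S ω
  obtain ⟨g, rfl⟩ := Module.projective_lifting_property b a hb
  obtain ⟨l, c, hc⟩ := Module.Finite.exists_fin' S (LinearMap.ker b)
  let ρ : freeModule S l ⟶ freeModule S r := ModuleCat.ofHom ((LinearMap.ker b).subtype ∘ₗ c)
  obtain ⟨y, hy⟩ := hT.exact ρ (ModuleCat.ofHom b : freeModule S r ⟶ ModuleCat.of S ω)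
    (fun x => ⟨fun hx => by
      obtain ⟨y, hy⟩ := hc ⟨x, hx⟩
      exact ⟨y, congrArg Subtype.val hy⟩, by
      rintro ⟨y, rfl⟩
      exact (c y).2⟩) hb
    (T.map (X := freeModule S n) (Y := freeModule S r) (ModuleCat.ofHom g) h)
    (by rw [map_map_apply]; exact ha)
  rw [← freePairing_map, ← hy, freePairing_map, ← LinearMap.comp_assoc]
  have : b ∘ₗ (LinearMap.ker b).subtype = 0 := LinearMap.ext fun x => x.2
  rw [this, LinearMap.zero_comp, map_zero]

/-- If `T(S)` is the dual of `ω` with respect to an injective module, then the elements of `T(M)`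
are detected by the maps `M → ω`. -/
theorem eq_zero_of_forall_map_eq_zero [IsNoetherianRing S] [Module.Finite S ω]
    (θ : T.obj (ModuleCat.of S S) ≃ₗ[S] (ω →ₗ[S] E))
    (hE : Module.Injective S E) (hT : IsRightExactOnFinite T) (M : ModuleCat.{u} S)
    [Module.Finite S M] (z : T.obj M)
    (hz : ∀ f : M ⟶ ModuleCat.of S ω, T.map f z = 0) : z = 0 := by
  obtain ⟨n, π, hπ⟩ := Module.Finite.exists_fin' S M
  obtain ⟨l, c, hc⟩ := Module.Finite.exists_fin' S (LinearMap.ker π)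
  let π' : freeModule S n ⟶ M := ModuleCat.ofHom π
  obtain ⟨y, rfl⟩ := hT.surjective π' hπ z
  let ρ := (LinearMap.ker π).subtype ∘ₗ c
  let A := LinearMap.lcomp S ω ρ
  -- The kernel of A is Hom(M, ω), where the pairing with y vanishes by `hz`. The pairing thus
  -- factors through the image of A, and injectivity of E extends it to Hom(S^l, ω).
  have hA : LinearMap.ker A ≤ LinearMap.ker (freePairing T θ n y) := by
    intro a ha
    have hle : LinearMap.ker π ≤ LinearMap.ker a := fun x hx => by
      obtain ⟨w, hw⟩ := hc ⟨x, hx⟩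
      have : x = ρ w := (congrArg Subtype.val hw).symm
      rw [this]
      exact LinearMap.congr_fun ha w
    let f : M →ₗ[S] ω := (LinearMap.ker π).liftQ a hle ∘ₗ
      (π.quotKerEquivOfSurjective hπ).symm.toLinearMap
    have hf : f ∘ₗ π = a := LinearMap.ext fun x => by
      have : (π.quotKerEquivOfSurjective hπ).symm (π x) = Submodule.Quotient.mk x := by
        rw [LinearEquiv.symm_apply_eq]
        rfl
      simp [f, this]
    refine freePairing_eq_zero θ hT ?_
    have := hz (ModuleCat.ofHom f)
    rw [map_map_apply] at this
    rw [← hf]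
    exact this
  obtain ⟨Ψ, hΨ⟩ := hE.out ((LinearMap.ker A).liftQ A le_rfl)
    (LinearMap.ker_eq_bot.1 (Submodule.ker_liftQ_eq_bot _ _ _ le_rfl))
    ((LinearMap.ker A).liftQ (freePairing T θ n y) hA)
  obtain ⟨y', rfl⟩ := freePairing_surjective T θ l Ψ
  -- So y comes from the relations of M, and its image in T(M) is zero.
  have hy : y = T.map (X := freeModule S l) (Y := freeModule S n) (ModuleCat.ofHom ρ) y' := by
    refine freePairing_injective T θ n (LinearMap.ext fun a => ?_)
    rw [freePairing_map]
    exact (hΨ (Submodule.Quotient.mk a)).symm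
  have hρ : (ModuleCat.ofHom ρ : freeModule S l ⟶ freeModule S n) ≫ π' = 0 := by
    refine ModuleCat.hom_ext (LinearMap.ext fun v => ?_)
    exact (c v).2
  rw [hy, map_map_apply, hρ, T.map_zero]
  rfl

end Duality

/-- Over a Noetherian ring, a class in `Ext^n(X, M)` with `X` finitely generated comes from a
finitely generated module mapping to `M`. -/
lemma exists_finite_comp_mk₀_eq [IsNoetherianRing S] (M : ModuleCat.{u} S) (n : ℕ) :
    ∀ (X : ModuleCat.{u} S) [Module.Finite S X] (α : Ext.{u} X M n),
      ∃ (N : ModuleCat.{u} S) (_ : Module.Finite S N) (φ : N ⟶ M) (β : Ext.{u} X N n),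
        β.comp (Ext.mk₀ φ) (add_zero n) = α := by
  induction n with
  | zero =>
    intro X _ α
    obtain ⟨f, rfl⟩ := Ext.homEquiv₀.symm.surjective α
    exact ⟨X, inferInstance, f, Ext.mk₀ (𝟙 X), Ext.mk₀_id_comp _⟩
  | succ n ih =>
    intro X _ α
    obtain ⟨P, _, _, _, _, f, hf⟩ := Module.exists_finite_presentation S X
    have hC := LinearMap.shortExact_shortComplexKer hf
    obtain ⟨γ, rfl⟩ := precomp_extClass_surjective_of_projective_X₂ M hC n α
    obtain ⟨N, hN, φ, β, rfl⟩ := ih (ModuleCat.of S (LinearMap.ker f)) γ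
    exact ⟨N, hN, φ, hC.extClass.comp β (add_comm 1 n), Ext.comp_assoc_of_third_deg_zero ..⟩

/-! ### Right exactness of top local cohomology and detection by ω. -/

namespace LocalCohomology

/-- The obstruction lies in H^(d+1) of the kernel, which vanishes because its support has dimension
at most d. -/
lemma map_surjective_of_surjective [IsNoetherianRing S] (I : Ideal S) {d : ℕ}
    (hd : ringKrullDim S = d) {P M : ModuleCat.{u} S} (f : P ⟶ M) [Module.Finite S P]
    (hf : Function.Surjective f) : Function.Surjective (map I d f) := by
  have hsub : Subsingleton (LocalCohomology I f.hom.shortComplexKer.X₁ (d + 1)) := by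
    refine subsingleton_of_supportDim_lt I (d + 1) (ModuleCat.of S (LinearMap.ker f.hom)) ?_
    refine (Module.supportDim_le_ringKrullDim S _).trans_lt ?_
    rw [hd]
    exact_mod_cast d.lt_succ_self
  exact map_surjective (C := f.hom.shortComplexKer)
    (LinearMap.shortExact_shortComplexKer (f := f.hom) hf) hsub

lemma exists_map_eq_of_exact [IsNoetherianRing S] (I : Ideal S) {d : ℕ}
    (hd : ringKrullDim S = d) {Q P M : ModuleCat.{u} S} (g : Q ⟶ P) (f : P ⟶ M)
    [Module.Finite S Q] (hgf : Function.Exact g f) (hf : Function.Surjective f)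
    (z : LocalCohomology I P d) (hz : map I d f z = 0) : ∃ y, map I d g y = z := by
  obtain ⟨y, hy⟩ := map_exact (C := f.hom.shortComplexKer)
    (LinearMap.shortExact_shortComplexKer (f := f.hom) hf) hz
  let g' : Q ⟶ ModuleCat.of S (LinearMap.ker f.hom) :=
    ModuleCat.ofHom (g.hom.codRestrict _ fun x => (hgf _).2 ⟨x, rfl⟩)
  have hg' : Function.Surjective g' := fun x => by
    obtain ⟨t, ht⟩ := (hgf x.1).1 x.2
    exact ⟨t, Subtype.ext ht⟩
  obtain ⟨y', hy'⟩ := map_surjective_of_surjective I hd g' hg' y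
  have hcomp : g' ≫ subtypeHom (LinearMap.ker f.hom) = g := rfl
  have := map_map_apply (functor S I d) g' (subtypeHom (LinearMap.ker f.hom)) y'
  rw [hcomp] at this
  refine ⟨y', this.symm.trans ?_⟩
  rw [← hy, ← hy']
  rfl

lemma isRightExactOnFinite [IsNoetherianRing S] (I : Ideal S) {d : ℕ}
    (hd : ringKrullDim S = d) : IsRightExactOnFinite (functor S I d) where
  surjective f _ hf := map_surjective_of_surjective I hd f hf
  exact g f _ _ hgf hf z hz := exists_map_eq_of_exact I hd g f hgf hf z hz

end LocalCohomology

/-- The elements of the top local cohomology of a finitely generated module are detected by the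
maps to a canonical module. -/
theorem IsCanonicalModule.eq_zero_of_forall_map_eq_zero [IsNoetherianRing S] [IsLocalRing S]
    {ω : ModuleCat.{u} S} (hω : IsCanonicalModule ω) {d : ℕ} (hd : ringKrullDim S = d)
    {I : Ideal S} (hI : I ≤ IsLocalRing.maximalIdeal S) {k : ℕ}
    (hk : IsLocalRing.maximalIdeal S ^ k ≤ I) (M : ModuleCat.{u} S) [Module.Finite S M]
    (z : LocalCohomology I M d) (hz : ∀ f : M ⟶ ω, LocalCohomology.map I d f z = 0) : z = 0 := by
  obtain ⟨d', E, hd', hE, ⟨e⟩⟩ := hω.dual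
  obtain rfl : d = d' := by
    rw [hd] at hd'
    exact_mod_cast hd'
  have := hω.finite
  -- The duality in `hω` concerns the maximal ideal; `r` transfers it to I.
  let r := LinearEquiv.ofBijective _
    (LocalCohomology.restrict_bijective (M := ModuleCat.of S S) (i := d) hI hk)
  exact CanonicalElement.eq_zero_of_forall_map_eq_zero (T := LocalCohomology.functor S I d)
    (r.symm.trans e.symm) hE.injective (LocalCohomology.isRightExactOnFinite I hd) M z hz

/-! ### The ideals (q, x) and (q, x^w), and the equivalences. -/

lemma quotMap_comp_nu (q : Ideal S) (x : S) {w : ℕ} (hw : 1 ≤ w)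
    (h : q ⊔ Ideal.span {x ^ w} ≤ q ⊔ Ideal.span {x}) :
    quotMap h ≫ nu q x hw = x ^ (w - 1) • 𝟙 _ := by
  refine ModuleCat.hom_ext (LinearMap.ext fun y => ?_)
  obtain ⟨y, rfl⟩ := Submodule.Quotient.mk_surjective _ y
  rfl

/-- The projection S/(q, x^w) → S/(q, x) followed by ν_w is multiplication by x^(w-1). -/
lemma restrict_theta_extMap_nu (q : Ideal S) (x : S) {w : ℕ} (hw : 1 ≤ w)
    (h : q ⊔ Ideal.span {x ^ w} ≤ q ⊔ Ideal.span {x}) (M : ModuleCat.{u} S) (i : ℕ)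
    (α : Ext.{u} (quot (q ⊔ Ideal.span {x ^ w})) M i) :
    LocalCohomology.restrict M i h (theta _ M i (extMap (nu q x hw) M i α)) =
      x ^ (w - 1) • theta _ M i α := by
  rw [LocalCohomology.restrict_theta, ← extMap_comp, quotMap_comp_nu, extMap_apply, Ext.mk₀_smul,
    Ext.smul_comp, Ext.mk₀_id_comp, map_smul]

lemma sup_span_pow_le (q : Ideal S) (x : S) {w : ℕ} (hw : 1 ≤ w) :
    q ⊔ Ideal.span {x ^ w} ≤ q ⊔ Ideal.span {x} :=
  sup_le_sup_left ((Ideal.span_singleton_le_span_singleton).2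
    (dvd_pow_self x (Nat.one_le_iff_ne_zero.1 hw))) q

lemma exists_sup_span_pow_le [IsNoetherianRing S] (q : Ideal S) (x : S) (w : ℕ) :
    ∃ k, (q ⊔ Ideal.span {x}) ^ k ≤ q ⊔ Ideal.span {x ^ w} :=
  Ideal.exists_pow_le_of_le_radical_of_fg
    (sup_le (le_sup_left.trans Ideal.le_radical) ((Ideal.span_singleton_le_iff_mem _).2
      ⟨w, Ideal.mem_sup_right (Ideal.mem_span_singleton_self _)⟩))
    (IsNoetherian.noetherian _)

/-- Every class in `Ext^i(X, M)` is the image of the class of `F_i → syz_i`. -/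
lemma exists_epsilon_comp_mk₀_eq {X : ModuleCat.{u} S} (F : ProjectiveResolution X)
    {M : ModuleCat.{u} S} {i : ℕ} (α : Ext.{u} X M i) :
    ∃ φ : syz F i ⟶ M, (epsilon F i).comp (Ext.mk₀ φ) (add_zero i) = α := by
  obtain ⟨f, hf, rfl⟩ := F.extMk_surjective α (i + 1) rfl
  have hle : LinearMap.range (F.complex.d (i + 1) i).hom ≤ LinearMap.ker f.hom := by
    rintro _ ⟨y, rfl⟩
    exact LinearMap.congr_fun (congrArg ModuleCat.Hom.hom hf) y
  refine ⟨ModuleCat.ofHom (Submodule.liftQ _ f.hom hle), ?_⟩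
  rw [epsilon, ProjectiveResolution.extMk_comp_mk₀]
  rfl

end CanonicalElement

end

theorem mainTheorem7 {S : Type u} [CommRing S] [IsNoetherianRing S] [IsLocalRing S]
    {G : Type v} [CommRing G] (hG : CanonicalElement.IsGorensteinRing G)
    (f : G →+* S) (hf : Function.Surjective f)
    (ω : ModuleCat.{u} S) (hω : CanonicalElement.IsCanonicalModule ω)
    (d : ℕ) (hd : ringKrullDim S = d)
    (q : Ideal S) (hq : q.height + 1 = d)
    (x : S) (hx : (q ⊔ Ideal.span {x}).radical = IsLocalRing.maximalIdeal S)
    (w : ℕ) (hw : 1 ≤ w)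
    (F : ProjectiveResolution (CanonicalElement.quot (q ⊔ Ideal.span {x ^ w})))
    (hF : ∀ i : ℕ, Module.Free S (F.complex.X i)) :
    List.TFAE [
      x ^ (w - 1) • CanonicalElement.eta F d ≠ 0,
      CanonicalElement.theta (q ⊔ Ideal.span {x}) ω d ∘ₗ
        CanonicalElement.extMap (CanonicalElement.nu q x hw) ω d ≠ 0,
      LinearMap.lsmul S
          (CanonicalElement.LocalCohomology (q ⊔ Ideal.span {x ^ w}) ω d) (x ^ (w - 1)) ∘ₗ
        CanonicalElement.theta (q ⊔ Ideal.span {x ^ w}) ω d ≠ 0] := by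
  open CanonicalElement in
  have hle := sup_span_pow_le q x hw
  obtain ⟨k, hk⟩ := exists_sup_span_pow_le q x w
  tfae_have 2 ↔ 3 := by
    refine not_congr ⟨fun h => LinearMap.ext fun α => ?_, fun h => LinearMap.ext fun α => ?_⟩
    · have := congrArg (LocalCohomology.restrict ω d hle) (LinearMap.congr_fun h α)
      rwa [LinearMap.comp_apply, restrict_theta_extMap_nu, LinearMap.zero_apply, map_zero] at this
    · refine (LocalCohomology.restrict_bijective hle hk).1 ?_
      rw [LinearMap.comp_apply, restrict_theta_extMap_nu, LinearMap.zero_apply, map_zero]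
      exact LinearMap.congr_fun h α
  tfae_have 3 → 1 := by
    refine mt fun h => LinearMap.ext fun α => ?_
    obtain ⟨φ, rfl⟩ := exists_epsilon_comp_mk₀_eq F α
    change x ^ (w - 1) • theta _ ω d _ = 0
    rw [← LocalCohomology.map_theta, ← map_smul]
    exact (congrArg _ h).trans (map_zero _)
  tfae_have 1 → 3 := by
    refine mt fun h => ?_
    obtain ⟨l, hl⟩ : ∃ l, IsLocalRing.maximalIdeal S ^ l ≤ q ⊔ Ideal.span {x} :=
      Ideal.exists_pow_le_of_le_radical_of_fg hx.ge (IsNoetherian.noetherian _)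
    have hI : IsLocalRing.maximalIdeal S ^ (l * k) ≤ q ⊔ Ideal.span {x ^ w} := by
      rw [pow_mul]
      exact (Ideal.pow_right_mono hl k).trans hk
    -- The free modules of F may have infinite rank, so detection by ω is applied to N, and the
    -- vanishing is then pushed along φ to syz_d.
    obtain ⟨N, hN, φ, β, hβ⟩ := exists_finite_comp_mk₀_eq (syz F d) d _ (epsilon F d)
    have hzero : x ^ (w - 1) • theta _ N d β = 0 := by
      refine hω.eq_zero_of_forall_map_eq_zero hd (hle.trans (Ideal.le_radical.trans hx.le)) hI N _
        fun g => ?_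
      rw [map_smul, LocalCohomology.map_theta]
      exact LinearMap.congr_fun h _
    rw [eta, ← hβ, ← LocalCohomology.map_theta, ← map_smul, hzero, map_zero]
  tfae_finish
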